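/- **Problem.** For finite simple graphs $G=(V_G,E_G)$ and $H=(V_H,E_H)$, a *common induced subgraph* of $G$ and $H$ is a function $f\colon V_G\to V_H\cup\{\bot\}$ such that, with $U=\{v\in V_G : f(v)\neq\bot\}$, the restriction $f|_U$ is an isomorphism from the induced subgraph $G[U]$ to the induced subgraph $H[f(U)]$. A *maximum common induced subgraph* (MCIS) is such an $f$ with $|U|$ as large as possible. The vertex cover number $\tau(\Gamma)$ of a graph $\Gamma$ is the minimum size of a set of vertices that meets every edge. **Model.** In the deterministic $\mathsf{CONGEST}$ model the communication network is a connected graph $G$ on $n\ge 1$ nodes. The nodes have distinct identifiers in $\{0,\dots,n^c-1\}$, where $c$ is a constant, and each node numbers its incident edges in an arbitrary way. All nodes run the same deterministic program in synchronous rounds, with unrestricted local computation; initially a node knows $n$, its own identifier and its degree. In each round every node may send a (possibly different) message of at most $\beta\lceil\log_2 n\rceil$ bits, where $\beta$ is a constant, over each of its incident edges, and then receives the messages of its neighbours. At some point every node must stop with a final local output. In distributed MCIS, every node also knows the whole graph $H$ from the start, and each node $v$ has to output $f(v)\in V_H\cup\{\bot\}$ so that the resulting global function $f$ is a maximum common induced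 subgraph of $G$ and $H$. **Theorem.** Maximum common induced subgraph on communication graph $G$ and target graph $H$ can be solved deterministically in the $\mathsf{CONGEST}$ model in $2^{O(\tau^2)}$ rounds, where $\tau=\max(\tau(G),\tau(H))$. Precisely: there is an absolute constant $C$ such that for every $c$ there are a constant $\beta$ and a deterministic program, using messages of at most $\beta\lceil\log_2 n\rceil$ bits, for which the following holds. For every connected graph $G$ with distinct identifiers in $\{0,\dots,n^c-1\}$ and every port numbering, and for every finite graph $H$ given to all nodes, all nodes stop within $2^{C\tau^2}$ rounds and their outputs form a maximum common induced subgraph of $G$ and $H$. (The value of $\tau(G)$ is not given to the nodes.) -/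

import Mathlib

/-! ### The deterministic `CONGEST` model -/

/-- A deterministic synchronous message-passing program, run by every node of the network.
Local computation is unrestricted, so the components are arbitrary functions.
A node with `d` neighbours has ports `0, …, d - 1`, one for each incident edge.
A message is a natural number (read as a bit string), and `none` is silence. -/
structure CongestAlgorithm (Output : Type) where
  /-- Local states. -/
  State : Type
  /-- Initial state, from the number of nodes, the node's own identifier, and its degree. -/
  init : (numNodes : ℕ) → (ident : ℕ) → (deg : ℕ) → State
  /-- The message sent through a given port, as a function of the current state. -/
  send : State → (port : ℕ) → Option ℕ
  /-- The new state, from the current one and the messages received through the ports. -/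
  receive : State → (inbox : ℕ → Option ℕ) → State
  /-- `some y` if the node has stopped with local output `y`, `none` if it is still running. -/
  output : State → Option Output

namespace CongestAlgorithm

variable {Output : Type} (A : CongestAlgorithm Output)

/-- The message actually sent: a stopped node is silent. -/
def message (s : A.State) (port : ℕ) : Option ℕ :=
  match A.output s with
  | some _ => none
  | none => A.send s port

/-- The state update actually made: the state (hence the output) of a stopped node is final. -/
def next (s : A.State) (inbox : ℕ → Option ℕ) : A.State :=
  match A.output s with
  | some _ => s
  | none => A.receive s inbox

end CongestAlgorithm

/-- The data that turn a graph `G` into a communication network: distinct identifiers that are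
smaller than `n ^ c`, where `n` is the number of nodes, and an arbitrary port numbering at
every node. -/
structure CongestNetwork {V : Type} [Fintype V] (G : SimpleGraph V) [DecidableRel G.Adj]
    (c : ℕ) where
  /-- Node identifiers. -/
  ident : V → ℕ
  ident_injective : Function.Injective ident
  ident_lt : ∀ v, ident v < Fintype.card V ^ c
  /-- The neighbour at the other end of each port. -/
  port : ∀ v, Fin (G.degree v) ≃ G.neighborSet v

namespace CongestNetwork

variable {V : Type} [Fintype V] {G : SimpleGraph V} [DecidableRel G.Adj] {c : ℕ}
  (N : CongestNetwork G c) {Output : Type} (A : CongestAlgorithm Output)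

/-- What the node `v` receives in a round at whose beginning the states are `s`: if port `i` of
`v` leads to `u`, then `v` gets through port `i` what `u` sends through its port towards `v`. -/
def inbox (s : V → A.State) (v : V) (i : ℕ) : Option ℕ :=
  if h : i < G.degree v then
    A.message (s (N.port v ⟨i, h⟩))
      ((N.port (N.port v ⟨i, h⟩)).symm ⟨v, SimpleGraph.Adj.symm (N.port v ⟨i, h⟩).2⟩ : ℕ)
  else none

/-- `N.state A t v` is the state of the node `v` after `t` synchronous rounds of `A`. -/
def state : ℕ → V → A.State
  | 0, v => A.init (Fintype.card V) (N.ident v) (G.degree v)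
  | t + 1, v => A.next (state t v) (N.inbox A (state t) v)

/-- In every round, every message over every edge has at most `β * ⌈log₂ n⌉` bits. -/
def RespectsBandwidth (β : ℕ) : Prop :=
  ∀ (t : ℕ) (v : V) (i : ℕ), i < G.degree v →
    ∀ m, A.message (N.state A t v) i = some m →
      Nat.size m ≤ β * Nat.clog 2 (Fintype.card V)

/-- After at most `T` rounds every node has stopped, and `f` is the function of local outputs. -/
def OutputsWithin (T : ℕ) (f : V → Output) : Prop :=
  ∀ v, A.output (N.state A T v) = some (f v)

end CongestNetwork

/-! ### Maximum common induced subgraph -/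

section MCIS

variable {V W : Type}

/-- The set of vertices that are mapped to something else than `⊥` (here `none`). -/
def mappedSet (f : V → Option W) : Set V := {v | f v ≠ none}

/-- The set of vertices of the target that are hit. -/
def imageSet (f : V → Option W) : Set W := {w | ∃ v, f v = some w}

/-- `f`, restricted to the vertices not mapped to `⊥`, is an isomorphism between the subgraphs
induced by its domain and by its image. -/
def IsCommonInducedSubgraph (G : SimpleGraph V) (H : SimpleGraph W) (f : V → Option W) : Prop :=
  ∃ e : G.induce (mappedSet f) ≃g H.induce (imageSet f),
    ∀ x : mappedSet f, f x = some (e x : W)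

/-- `f` is a common induced subgraph of `G` and `H` with the largest number of vertices. -/
def IsMaximumCommonInducedSubgraph (G : SimpleGraph V) (H : SimpleGraph W)
    (f : V → Option W) : Prop :=
  IsCommonInducedSubgraph G H f ∧
    ∀ g : V → Option W, IsCommonInducedSubgraph G H g →
      (mappedSet g).ncard ≤ (mappedSet f).ncard

end MCIS

/-!
All nodes learn the communication graph `G` up to isomorphism and their own positions in it; then
they agree on the same maximum common induced subgraph without further communication.

The vertices that have a neighbour whose degree is not larger than their own form a vertex cover `D`
of size `O(τ²)`, where `τ` is the vertex cover number of `G`, and a node needs only the degrees of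
its neighbours to see whether it belongs to `D`. The vertices outside `D` fall into twin classes
according to their neighbourhoods, which are subsets of `D`. So `G` is determined by the list of
classes with their sizes and neighbourhoods. It consists of `2 ^ O(τ)` tokens of `O(log n)` bits,
each mentioning one class and one element of its neighbourhood.

A vertex outside `D` has at most `|D|` neighbours, and it tells them to its neighbours one by one.
All members of its class are adjacent to the same vertices of `D`, which therefore see the whole
class and form its tokens. The tokens are flooded, and since a path is at most twice as long as a
vertex cover is large, all of them reach all nodes in a number of rounds that is quadratic in the
number of tokens. The nodes do not know `τ`, but each token accounts for an equal share of the
vertices of its class, so that a set of tokens is complete exactly when its shares add up to `n`.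
Hence all nodes can stop in the same round, which depends only on the number of tokens.
-/

/-! ### Common induced subgraphs -/

section CommonInducedSubgraph

variable {V V' W : Type} {G : SimpleGraph V} {G' : SimpleGraph V'} {H : SimpleGraph W}

theorem isCommonInducedSubgraph_iff {f : V → Option W} :
    IsCommonInducedSubgraph G H f ↔
      ∀ u v a b, f u = some a → f v = some b → (u = v ↔ a = b) ∧ (G.Adj u v ↔ H.Adj a b) := by
  constructor
  · rintro ⟨e, he⟩ u v a b hu hv
    obtain ⟨x, rfl⟩ : ∃ x : mappedSet f, x = u := ⟨⟨u, by simp [mappedSet, hu]⟩, rfl⟩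
    obtain ⟨y, rfl⟩ : ∃ y : mappedSet f, y = v := ⟨⟨v, by simp [mappedSet, hv]⟩, rfl⟩
    obtain rfl : (e x : W) = a := Option.some.inj ((he x).symm.trans hu)
    obtain rfl : (e y : W) = b := Option.some.inj ((he y).symm.trans hv)
    exact ⟨by simp only [← Subtype.ext_iff, e.injective.eq_iff], e.map_adj_iff.symm⟩
  · intro h
    choose g hg using fun x : mappedSet f => Option.ne_none_iff_exists'.mp x.2
    have hbij : Function.Bijective fun x : mappedSet f => (⟨g x, x, hg x⟩ : imageSet f) := by
      refine ⟨fun x y hxy => ?_, ?_⟩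
      · exact Subtype.ext ((h x y _ _ (hg x) (hg y)).1.2 (congrArg Subtype.val hxy))
      · rintro ⟨w, v, hv⟩
        have hvf : v ∈ mappedSet f := by simp [mappedSet, hv]
        exact ⟨⟨v, hvf⟩, Subtype.ext (Option.some.inj ((hg ⟨v, hvf⟩).symm.trans hv))⟩
    exact ⟨⟨Equiv.ofBijective _ hbij, fun {x y} => (h x y _ _ (hg x) (hg y)).2.symm⟩, hg⟩

theorem exists_isMaximumCommonInducedSubgraph [Finite V] [Finite W] (G : SimpleGraph V)
    (H : SimpleGraph W) : ∃ f : V → Option W, IsMaximumCommonInducedSubgraph G H f :=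
  Set.exists_max_image {f : V → Option W | IsCommonInducedSubgraph G H f}
    (fun f => (mappedSet f).ncard) (Set.toFinite _)
    ⟨fun _ => none, isCommonInducedSubgraph_iff.2 fun _ _ _ _ h => by simp at h⟩

theorem IsCommonInducedSubgraph.comp_iso {f : V' → Option W}
    (hf : IsCommonInducedSubgraph G' H f) (e : G ≃g G') : IsCommonInducedSubgraph G H (f ∘ e) := by
  rw [isCommonInducedSubgraph_iff] at hf ⊢
  intro u v a b hu hv
  simpa only [e.injective.eq_iff, e.map_adj_iff] using hf (e u) (e v) a b hu hv

theorem ncard_mappedSet_comp_equiv (f : V' → Option W) (e : V ≃ V') :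
    (mappedSet (f ∘ e)).ncard = (mappedSet f).ncard :=
  Set.ncard_preimage_of_injective_subset_range (s := mappedSet f) e.injective
    (by simp only [e.surjective.range_eq, Set.subset_univ])

theorem IsMaximumCommonInducedSubgraph.comp_iso {f : V' → Option W}
    (hf : IsMaximumCommonInducedSubgraph G' H f) (e : G ≃g G') :
    IsMaximumCommonInducedSubgraph G H (f ∘ e) := by
  refine ⟨hf.1.comp_iso e, fun g hg => ?_⟩
  calc (mappedSet g).ncard = (mappedSet (g ∘ e.symm)).ncard :=
        (ncard_mappedSet_comp_equiv g e.symm.toEquiv).symm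
    _ ≤ (mappedSet f).ncard := hf.2 _ (hg.comp_iso e.symm)
    _ = (mappedSet (f ∘ e)).ncard := (ncard_mappedSet_comp_equiv f e.toEquiv).symm

end CommonInducedSubgraph

/-! ### Vertex covers -/

section VertexCover

open Finset

variable {V : Type*} {G : SimpleGraph V}

theorem length_add_ite_le_two_mul_countP_support {C : Set V} [DecidablePred (· ∈ C)]
    (hC : G.IsVertexCover C) {u v : V} (p : G.Walk u v) :
    p.length + (if u ∈ C then 1 else 0) ≤ 2 * p.support.countP (· ∈ C) := by
  induction p with
  | @nil a => by_cases ha : a ∈ C <;> simp [ha]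
  | @cons a b _ hab q ih =>
    have hcover := hC hab
    by_cases ha : a ∈ C <;> by_cases hb : b ∈ C <;>
      simp_all <;> omega

theorem length_le_two_mul_card_of_isPath {C : Finset V} (hC : G.IsVertexCover C) {u v : V}
    {p : G.Walk u v} (hp : p.IsPath) : p.length ≤ 2 * #C := by
  classical
  have hcount : p.support.countP (· ∈ (C : Set V)) ≤ #C := by
    rw [List.countP_eq_length_filter, ← List.toFinset_card_of_nodup (hp.support_nodup.filter _)]
    exact card_le_card fun x hx => by simpa using (List.mem_filter.1 (List.mem_toFinset.1 hx)).2
  have hlength := length_add_ite_le_two_mul_countP_support hC p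
  omega

variable [Fintype V] [DecidableRel G.Adj]

variable (G) in
open scoped Classical in
/-- The vertices having a neighbour whose degree is not larger than their own. This vertex cover
is quadratic in the vertex cover number, and a node recognizes its membership from the degrees of
its neighbours. -/
noncomputable def degreeCover : Finset V := {v | ∃ u, G.Adj v u ∧ G.degree u ≤ G.degree v}

theorem mem_degreeCover {v : V} :
    v ∈ degreeCover G ↔ ∃ u, G.Adj v u ∧ G.degree u ≤ G.degree v := by
  simp [degreeCover]

theorem isVertexCover_degreeCover : G.IsVertexCover (degreeCover G) := fun u v h => by
  simp only [mem_coe, mem_degreeCover]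
  exact (le_total (G.degree v) (G.degree u)).imp (⟨v, h, ·⟩) (⟨u, h.symm, ·⟩)

-- A vertex of the degree cover outside `S` has all its neighbours in `S`, hence degree at most
-- `#S`, and so it is adjacent to a vertex of `S` of degree at most `#S`.
theorem card_degreeCover_le {S : Finset V} (hS : G.IsVertexCover S) :
    #(degreeCover G) ≤ #S + #S ^ 2 := by
  classical
  have hsub : degreeCover G ⊆ S ∪ {u ∈ S | G.degree u ≤ #S}.biUnion (G.neighborFinset ·) := by
    intro v hv
    by_cases hvS : v ∈ S
    · exact mem_union_left _ hvS
    obtain ⟨u, hvu, hdeg⟩ := mem_degreeCover.1 hv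
    have hN : ∀ w, G.Adj v w → w ∈ S := fun w hw => (hS hw).resolve_left hvS
    have hd : G.degree v ≤ #S := card_le_card fun w hw => hN w (by simpa using hw)
    exact mem_union_right _ <| mem_biUnion.2
      ⟨u, mem_filter.2 ⟨hN u hvu, hdeg.trans hd⟩, by simpa using hvu.symm⟩
  have hunion : #({u ∈ S | G.degree u ≤ #S}.biUnion (G.neighborFinset ·)) ≤ #S * #S :=
    (card_biUnion_le_card_mul _ _ #S fun u hu => (mem_filter.1 hu).2).trans <|
      Nat.mul_le_mul_right _ (card_filter_le _ _)
  calc #(degreeCover G) ≤ #S + #({u ∈ S | G.degree u ≤ #S}.biUnion (G.neighborFinset ·)) :=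
        (card_le_card hsub).trans (card_union_le _ _)
    _ ≤ #S + #S ^ 2 := by rw [sq]; gcongr

end VertexCover

/-! ### Description of a graph by tokens -/

section ClassLabel

open Finset

/-- The label of the vertex identified by `a` in the class of vertices identified by `I`: the
smallest identifier in the class, and the position of `a` in the class. -/
noncomputable def classLabel (I : Finset ℕ) (a : ℕ) : ℕ × ℕ :=
  (sInf (I : Set ℕ), Nat.count (· ∈ I) a)

theorem sInf_coe_mem {I : Finset ℕ} (hI : I.Nonempty) : sInf (I : Set ℕ) ∈ I :=
  mem_coe.1 (Nat.sInf_mem hI)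

theorem count_mem_lt_card {I : Finset ℕ} {a : ℕ} (ha : a ∈ I) : Nat.count (· ∈ I) a < #I := by
  simpa using Nat.count_lt_card (p := (· ∈ I)) I.finite_toSet ha

theorem exists_count_mem_eq {I : Finset ℕ} {k : ℕ} (hk : k < #I) :
    ∃ a ∈ I, Nat.count (· ∈ I) a = k := by
  have hk' : k < #(I.finite_toSet.toFinset) := by simpa using hk
  exact ⟨_, Nat.nth_mem_of_lt_card (p := (· ∈ I)) I.finite_toSet hk',
    Nat.count_nth_of_lt_card_finite (p := (· ∈ I)) I.finite_toSet hk'⟩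

end ClassLabel

section ClassToken

open Finset

/-- One unit of the description of a graph by classes of vertices with the same neighbours in a
vertex cover: it tells about the class represented by `rep` that it has `size` vertices and that
`item` is one of the `traceCard` cover vertices meeting their closed neighbourhoods. -/
@[ext]
structure ClassToken where
  /-- The smallest identifier in the class. -/
  rep : ℕ
  /-- The number of vertices in the class. -/
  size : ℕ
  /-- The number of tokens of the class. -/
  traceCard : ℕ
  /-- The identifier of a cover vertex. -/
  item : ℕ
deriving DecidableEq

/-- The part of the class that a token accounts for, so that the shares of all tokens of a class
add up to its size. -/
def ClassToken.share (t : ClassToken) : ℚ := t.size / t.traceCard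

/-- The tokens of the class with identifiers `I` and neighbourhood trace `T`. -/
noncomputable def classTokens (I T : Finset ℕ) : Finset ClassToken :=
  T.image fun x => ⟨sInf (I : Set ℕ), #I, #T, x⟩

theorem mem_classTokens {I T : Finset ℕ} {t : ClassToken} :
    t ∈ classTokens I T ↔
      t.rep = sInf (I : Set ℕ) ∧ t.size = #I ∧ t.traceCard = #T ∧ t.item ∈ T := by
  simp only [classTokens, mem_image, ClassToken.ext_iff]
  constructor
  · rintro ⟨x, hx, hrep, hsize, htrace, rfl⟩
    exact ⟨hrep.symm, hsize.symm, htrace.symm, hx⟩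
  · rintro ⟨hrep, hsize, htrace, hx⟩
    exact ⟨t.item, hx, hrep.symm, hsize.symm, htrace.symm, rfl⟩

theorem card_classTokens (I T : Finset ℕ) : #(classTokens I T) = #T :=
  card_image_of_injective _ fun _ _ h => congrArg ClassToken.item h

/-- The labels of the vertices of the classes mentioned by a set of tokens. -/
def tokenLabels (K : Finset ClassToken) : Set (ℕ × ℕ) := {l | ∃ t ∈ K, t.rep = l.1 ∧ l.2 < t.size}

theorem finite_tokenLabels (K : Finset ClassToken) : (tokenLabels K).Finite := by
  refine (K.finite_toSet.biUnion fun t _ => (Set.finite_Iio t.size).image (t.rep, ·)).subset ?_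
  rintro ⟨r, k⟩ ⟨t, ht, hr, hk⟩
  exact Set.mem_biUnion ht ⟨k, hk, Prod.ext hr rfl⟩

instance (K : Finset ClassToken) : Finite (tokenLabels K) := (finite_tokenLabels K).to_subtype

/-- The graph on labels that is described by a set of tokens. -/
def labelGraph (K : Finset ClassToken) : SimpleGraph (tokenLabels K) :=
  SimpleGraph.fromRel fun a b => ∃ t ∈ K, t.rep = a.1.1 ∧ t.item = b.1.1

end ClassToken

/-- A vertex cover together with numbers identifying the vertices. Vertices outside the cover with
the same neighbours form twin classes, and a description of all classes by tokens determines the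
graph. -/
structure IdentifiedCover {V : Type*} (G : SimpleGraph V) where
  /-- The vertex cover. -/
  cover : Finset V
  isVertexCover : G.IsVertexCover cover
  /-- The identifier of a vertex. -/
  ident : V ↪ ℕ

namespace IdentifiedCover

open Finset

variable {V : Type*} {G : SimpleGraph V} (K : IdentifiedCover G) {u v x : V}

theorem mem_cover_of_adj (h : G.Adj u v) (hu : u ∉ K.cover) : v ∈ K.cover :=
  (K.isVertexCover h).resolve_left hu

open scoped Classical in
/-- The identifiers of the cover vertices in the closed neighbourhood of `v`. -/
noncomputable def trace (v : V) : Finset ℕ :=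
  (K.cover.filter fun x => x = v ∨ G.Adj x v).map K.ident

theorem ident_mem_trace : K.ident x ∈ K.trace v ↔ x ∈ K.cover ∧ (x = v ∨ G.Adj x v) := by
  simp [trace]

theorem card_trace_le (v : V) : #(K.trace v) ≤ #K.cover := by
  classical
  exact (card_map _).trans_le (card_filter_le _ _)

theorem trace_nonempty (hG : ∀ v, ∃ u, G.Adj v u) (v : V) : (K.trace v).Nonempty := by
  by_cases hv : v ∈ K.cover
  · exact ⟨_, K.ident_mem_trace.2 ⟨hv, .inl rfl⟩⟩
  · obtain ⟨u, hu⟩ := hG v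
    exact ⟨_, K.ident_mem_trace.2 ⟨K.mem_cover_of_adj hu hv, .inr hu.symm⟩⟩

variable [Fintype V]

theorem trace_of_notMem [DecidableRel G.Adj] (hv : v ∉ K.cover) :
    K.trace v = (G.neighborFinset v).map K.ident := by
  classical
  rw [trace]
  congr 1
  ext x
  simp only [mem_filter, SimpleGraph.mem_neighborFinset, G.adj_comm x]
  exact ⟨fun ⟨hx, h⟩ => h.resolve_left fun hxv => hv (hxv ▸ hx),
    fun h => ⟨K.mem_cover_of_adj h hv, .inr h⟩⟩

open scoped Classical in
/-- Cover vertices form classes of their own, and other vertices are classified by their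
neighbours. -/
noncomputable def twinClass (v : V) : Finset V :=
  if v ∈ K.cover then {v} else univ.filter fun u => u ∉ K.cover ∧ K.trace u = K.trace v

theorem twinClass_of_mem (hv : v ∈ K.cover) : K.twinClass v = {v} := by
  simp [twinClass, hv]

theorem mem_twinClass_of_notMem (hv : v ∉ K.cover) :
    u ∈ K.twinClass v ↔ u ∉ K.cover ∧ K.trace u = K.trace v := by
  simp [twinClass, hv]

theorem self_mem_twinClass (v : V) : v ∈ K.twinClass v := by
  by_cases hv : v ∈ K.cover <;> simp [twinClass, hv]

theorem trace_eq_of_mem_twinClass (h : u ∈ K.twinClass v) : K.trace u = K.trace v := by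
  by_cases hv : v ∈ K.cover
  · rw [K.twinClass_of_mem hv, mem_singleton] at h
    rw [h]
  · exact ((K.mem_twinClass_of_notMem hv).1 h).2

theorem twinClass_eq_of_mem (h : u ∈ K.twinClass v) : K.twinClass u = K.twinClass v := by
  by_cases hv : v ∈ K.cover
  · rw [K.twinClass_of_mem hv, mem_singleton] at h
    rw [h]
  · obtain ⟨hu, htrace⟩ := (K.mem_twinClass_of_notMem hv).1 h
    ext w
    rw [K.mem_twinClass_of_notMem hu, K.mem_twinClass_of_notMem hv, htrace]

/-- The identifiers of the vertices in the class of `v`. -/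
noncomputable def classIdents (v : V) : Finset ℕ := (K.twinClass v).map K.ident

/-- The smallest identifier in the class of `v`. -/
noncomputable def rep (v : V) : ℕ := sInf (K.classIdents v : Set ℕ)

/-- The label of `v`: the representative of its class and its position there. -/
noncomputable def label (v : V) : ℕ × ℕ := classLabel (K.classIdents v) (K.ident v)

theorem ident_mem_classIdents : K.ident u ∈ K.classIdents v ↔ u ∈ K.twinClass v := by
  simp [classIdents]

theorem self_mem_classIdents (v : V) : K.ident v ∈ K.classIdents v :=
  K.ident_mem_classIdents.2 (K.self_mem_twinClass v)

theorem classIdents_of_mem (hv : v ∈ K.cover) : K.classIdents v = {K.ident v} := by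
  rw [classIdents, K.twinClass_of_mem hv, map_singleton]

theorem classIdents_eq_of_mem (h : u ∈ K.twinClass v) : K.classIdents u = K.classIdents v := by
  rw [classIdents, K.twinClass_eq_of_mem h, classIdents]

theorem exists_ident_eq_rep (v : V) : ∃ u ∈ K.twinClass v, K.ident u = K.rep v :=
  mem_map.1 (sInf_coe_mem ⟨_, K.self_mem_classIdents v⟩)

theorem rep_eq_rep_iff : K.rep u = K.rep v ↔ u ∈ K.twinClass v := by
  refine ⟨fun h => ?_, fun h => by rw [rep, K.classIdents_eq_of_mem h, rep]⟩
  obtain ⟨a, hau, ha⟩ := K.exists_ident_eq_rep u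
  obtain ⟨b, hbv, hb⟩ := K.exists_ident_eq_rep v
  obtain rfl : a = b := K.ident.injective (by rw [ha, hb, h])
  rw [← K.twinClass_eq_of_mem hbv, K.twinClass_eq_of_mem hau]
  exact K.self_mem_twinClass u

theorem rep_mem_trace : K.rep u ∈ K.trace v ↔ u ∈ K.cover ∧ (u = v ∨ G.Adj u v) := by
  obtain ⟨a, hau, ha⟩ := K.exists_ident_eq_rep u
  rw [← ha, K.ident_mem_trace]
  by_cases hu : u ∈ K.cover
  · rw [K.twinClass_of_mem hu, mem_singleton] at hau
    rw [hau]
  · simp only [hu, ((K.mem_twinClass_of_notMem hu).1 hau).1, false_and]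

theorem label_injective : Function.Injective K.label := fun u v h => by
  have hu : u ∈ K.twinClass v := K.rep_eq_rep_iff.1 (congrArg Prod.fst h)
  have hcount : Nat.count (· ∈ K.classIdents u) (K.ident u)
      = Nat.count (· ∈ K.classIdents v) (K.ident v) := congrArg Prod.snd h
  rw [K.classIdents_eq_of_mem hu] at hcount
  exact K.ident.injective <|
    Nat.count_injective (K.ident_mem_classIdents.2 hu) (K.self_mem_classIdents v) hcount

theorem exists_label_eq {k : ℕ} (hk : k < #(K.classIdents v)) : ∃ u, K.label u = (K.rep v, k) := by
  obtain ⟨a, ha, hak⟩ := exists_count_mem_eq hk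
  obtain ⟨u, hu, rfl⟩ := mem_map.1 ha
  exact ⟨u, by rw [label, K.classIdents_eq_of_mem hu, classLabel, hak, rep]⟩

/-- The tokens describing the class of `v`. -/
noncomputable def vertexTokens (v : V) : Finset ClassToken :=
  classTokens (K.classIdents v) (K.trace v)

/-- The tokens describing the whole graph. -/
noncomputable def tokens : Finset ClassToken := univ.biUnion K.vertexTokens

theorem mem_tokens {t : ClassToken} : t ∈ K.tokens ↔ ∃ v, t ∈ K.vertexTokens v := by
  simp [tokens]

theorem vertexTokens_subset_tokens (v : V) : K.vertexTokens v ⊆ K.tokens :=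
  fun _ ht => K.mem_tokens.2 ⟨v, ht⟩

theorem mem_vertexTokens_iff_mem_twinClass {t : ClassToken} (ht : t ∈ K.vertexTokens v) :
    t ∈ K.vertexTokens u ↔ u ∈ K.twinClass v := by
  refine ⟨fun h => K.rep_eq_rep_iff.1 ?_, fun h => ?_⟩
  · rw [rep, rep, ← (mem_classTokens.1 ht).1, ← (mem_classTokens.1 h).1]
  · rwa [vertexTokens, K.classIdents_eq_of_mem h, K.trace_eq_of_mem_twinClass h]

theorem exists_mem_tokens_iff {i : ℕ} :
    (∃ t ∈ K.tokens, t.rep = K.rep v ∧ t.item = i) ↔ i ∈ K.trace v := by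
  constructor
  · rintro ⟨t, ht, hrep, rfl⟩
    obtain ⟨u, hu⟩ := K.mem_tokens.1 ht
    have hmem := mem_classTokens.1 hu
    rw [← K.trace_eq_of_mem_twinClass (K.rep_eq_rep_iff.1 (hmem.1.symm.trans hrep))]
    exact hmem.2.2.2
  · exact fun hi => ⟨⟨K.rep v, _, _, i⟩, K.vertexTokens_subset_tokens v <|
      mem_classTokens.2 ⟨rfl, rfl, rfl, hi⟩, rfl, rfl⟩

theorem label_mem_tokenLabels (hG : ∀ v, ∃ u, G.Adj v u) (v : V) :
    K.label v ∈ tokenLabels K.tokens := by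
  obtain ⟨x, hx⟩ := K.trace_nonempty hG v
  exact ⟨⟨K.rep v, #(K.classIdents v), _, x⟩, K.vertexTokens_subset_tokens v <|
    mem_classTokens.2 ⟨rfl, rfl, rfl, hx⟩, rfl, count_mem_lt_card (K.self_mem_classIdents v)⟩

theorem exists_label_eq_of_mem_tokenLabels {l : ℕ × ℕ} (hl : l ∈ tokenLabels K.tokens) :
    ∃ v, K.label v = l := by
  obtain ⟨t, ht, hrep, hsize⟩ := hl
  obtain ⟨v, hv⟩ := K.mem_tokens.1 ht
  obtain ⟨htrep, htsize, -, -⟩ := mem_classTokens.1 hv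
  obtain ⟨u, hu⟩ := K.exists_label_eq (htsize ▸ hsize)
  exact ⟨u, hu.trans (Prod.ext (htrep.symm.trans hrep) rfl)⟩

/-- Sending every vertex to its label recovers the graph from the tokens. -/
noncomputable def labelIso (hG : ∀ v, ∃ u, G.Adj v u) : G ≃g labelGraph K.tokens where
  toEquiv := Equiv.ofBijective (fun v => ⟨K.label v, K.label_mem_tokenLabels hG v⟩)
    ⟨fun _ _ h => K.label_injective (congrArg Subtype.val h), fun ⟨_, hl⟩ =>
      (K.exists_label_eq_of_mem_tokenLabels hl).imp fun _ h => Subtype.ext h⟩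
  map_rel_iff' {u v} := by
    rw [labelGraph, SimpleGraph.fromRel_adj]
    change _ ≠ _ ∧ ((∃ t ∈ K.tokens, t.rep = K.rep u ∧ t.item = K.rep v) ∨
      ∃ t ∈ K.tokens, t.rep = K.rep v ∧ t.item = K.rep u) ↔ G.Adj u v
    rw [(Equiv.injective _).ne_iff, K.exists_mem_tokens_iff, K.exists_mem_tokens_iff,
      K.rep_mem_trace, K.rep_mem_trace]
    have hcover : G.Adj u v → u ∈ K.cover ∨ v ∈ K.cover := fun h => K.isVertexCover h
    have hne : G.Adj u v → u ≠ v := G.ne_of_adj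
    grind [G.adj_comm u v]

theorem card_cover_le_card_tokens : #K.cover ≤ #K.tokens := by
  refine card_le_card_of_injOn
    (fun v => ⟨K.rep v, #(K.classIdents v), #(K.trace v), K.ident v⟩) (fun v hv => ?_)
    fun _ _ _ _ h => K.ident.injective (congrArg ClassToken.item h)
  exact K.vertexTokens_subset_tokens v <| mem_classTokens.2
    ⟨rfl, rfl, rfl, K.ident_mem_trace.2 ⟨hv, .inl rfl⟩⟩

-- A vertex outside both covers has its neighbours in their intersection, so that there are at
-- most `2 ^ #S` classes of such vertices.
theorem card_tokens_le {S : Finset V} (hS : G.IsVertexCover S) :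
    #K.tokens ≤ (#K.cover + #S + 2 ^ #S) * #K.cover := by
  classical
  set C := (K.cover ∩ S).map K.ident
  let lowTokens (T : Finset ℕ) : Finset ClassToken :=
    classTokens ((univ.filter fun u => u ∉ K.cover ∧ K.trace u = T).map K.ident) T
  have hsub : K.tokens ⊆
      (K.cover ∪ S).biUnion K.vertexTokens ∪ C.powerset.biUnion lowTokens := by
    intro t ht
    obtain ⟨v, hv⟩ := K.mem_tokens.1 ht
    by_cases hvCS : v ∈ K.cover ∪ S
    · exact mem_union_left _ (mem_biUnion.2 ⟨v, hvCS, hv⟩)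
    obtain ⟨hvC, hvS⟩ := notMem_union.1 hvCS
    refine mem_union_right _ (mem_biUnion.2 ⟨K.trace v, mem_powerset.2 ?_, ?_⟩)
    · rw [K.trace_of_notMem hvC]
      refine map_subset_map.2 fun x hx => ?_
      have hvx : G.Adj v x := by simpa using hx
      exact mem_inter.2 ⟨K.mem_cover_of_adj hvx hvC, (hS hvx).resolve_left hvS⟩
    · rwa [vertexTokens, classIdents, twinClass, if_neg hvC] at hv
  have hhigh : #((K.cover ∪ S).biUnion K.vertexTokens) ≤ (#K.cover + #S) * #K.cover :=
    (card_biUnion_le_card_mul _ _ _ fun v _ =>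
      (card_classTokens _ _).trans_le (K.card_trace_le v)).trans <|
        Nat.mul_le_mul_right _ (card_union_le _ _)
  have hlow : #(C.powerset.biUnion lowTokens) ≤ 2 ^ #S * #K.cover := by
    refine (card_biUnion_le_card_mul _ _ #K.cover fun T hT => ?_).trans ?_
    · refine (card_classTokens _ _).trans_le ((card_le_card (mem_powerset.1 hT)).trans ?_)
      exact (card_map _).trans_le (card_le_card inter_subset_left)
    · rw [card_powerset, card_map]
      gcongr
      exacts [one_le_two, inter_subset_right]
  calc #K.tokens ≤ _ := (card_le_card hsub).trans (card_union_le _ _)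
    _ ≤ (#K.cover + #S) * #K.cover + 2 ^ #S * #K.cover := by gcongr
    _ = (#K.cover + #S + 2 ^ #S) * #K.cover := by ring

theorem share_pos {t : ClassToken} (ht : t ∈ K.tokens) : 0 < t.share := by
  obtain ⟨v, hv⟩ := K.mem_tokens.1 ht
  obtain ⟨-, hsize, htrace, hitem⟩ := mem_classTokens.1 hv
  have hsize_pos : 0 < t.size := hsize ▸ card_pos.2 ⟨_, K.self_mem_classIdents v⟩
  have htrace_pos : 0 < t.traceCard := htrace ▸ card_pos.2 ⟨_, hitem⟩
  exact div_pos (Nat.cast_pos.2 hsize_pos) (Nat.cast_pos.2 htrace_pos)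

-- Every vertex distributes a unit evenly among the tokens of its class.
theorem sum_share_tokens (hG : ∀ v, ∃ u, G.Adj v u) :
    ∑ t ∈ K.tokens, t.share = Fintype.card V := by
  classical
  have hshare : ∀ t ∈ K.tokens,
      t.share = ∑ v with t ∈ K.vertexTokens v, (1 / t.traceCard : ℚ) := fun t ht => by
    obtain ⟨v, hv⟩ := K.mem_tokens.1 ht
    have hclass : ({u | t ∈ K.vertexTokens u} : Finset V) = K.twinClass v := by
      ext u
      rw [mem_filter_univ, K.mem_vertexTokens_iff_mem_twinClass hv]
    rw [hclass, sum_const, nsmul_eq_mul, ClassToken.share, (mem_classTokens.1 hv).2.1,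
      classIdents, card_map, mul_one_div]
  have hunit : ∀ v, ∑ t ∈ K.vertexTokens v, (1 / t.traceCard : ℚ) = 1 := fun v => by
    rw [sum_congr rfl fun t ht => by rw [(mem_classTokens.1 ht).2.2.1], sum_const, nsmul_eq_mul,
      vertexTokens, card_classTokens]
    exact mul_one_div_cancel (Nat.cast_ne_zero.2 (K.trace_nonempty hG v).card_pos.ne')
  calc ∑ t ∈ K.tokens, t.share
      = ∑ t ∈ K.tokens, ∑ v with t ∈ K.vertexTokens v, (1 / t.traceCard : ℚ) :=
        sum_congr rfl hshare
    _ = ∑ v, ∑ t ∈ K.vertexTokens v, (1 / t.traceCard : ℚ) :=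
        sum_comm' fun t v => by
          simp only [mem_filter_univ, mem_univ, and_true, and_iff_right_iff_imp]
          exact fun h => K.vertexTokens_subset_tokens v h
    _ = Fintype.card V := by simp only [hunit, sum_const, card_univ, nsmul_one]

theorem eq_tokens_of_sum_share (hG : ∀ v, ∃ u, G.Adj v u) {T : Finset ClassToken}
    (hT : T ⊆ K.tokens) (hsum : ∑ t ∈ T, t.share = Fintype.card V) : T = K.tokens := by
  by_contra hne
  obtain ⟨t, ht, htT⟩ := exists_of_ssubset (hT.ssubset_of_ne hne)
  refine (sum_lt_sum_of_subset hT ht htT (K.share_pos ht) fun s hs _ => (K.share_pos hs).le).ne ?_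
  rw [hsum, K.sum_share_tokens hG]

end IdentifiedCover

/-! ### Protocols and flooding -/

/-- A round-based program without stopping rule, whose messages are of an arbitrary type. -/
structure Protocol (σ μ : Type) where
  /-- Initial state, from the number of nodes, the node's own identifier, and its degree. -/
  init : (numNodes : ℕ) → (ident : ℕ) → (deg : ℕ) → σ
  /-- The message sent through a given port. -/
  send : σ → (port : ℕ) → μ
  /-- The new state, from the current one and the messages received through the ports. -/
  receive : σ → (inbox : ℕ → Option μ) → σ

/-- The program that runs a protocol, with messages encoded by numbers, until `out` returns an
output. -/
def Protocol.toAlgorithm {σ μ Output : Type} [Encodable μ] (P : Protocol σ μ)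
    (out : σ → Option Output) : CongestAlgorithm Output where
  State := σ
  init := P.init
  send s i := some (Encodable.encode (P.send s i))
  receive s inbox := P.receive s fun i => (inbox i).bind Encodable.decode
  output := out

namespace CongestNetwork

variable {V : Type} [Fintype V] {G : SimpleGraph V} [DecidableRel G.Adj] {c : ℕ}
  (N : CongestNetwork G c)

/-- The neighbour at a port. -/
def nbr (v : V) (i : Fin (G.degree v)) : V := N.port v i

theorem adj_nbr (v : V) (i : Fin (G.degree v)) : G.Adj v (N.nbr v i) := (N.port v i).2

theorem exists_nbr_eq {v u : V} (h : G.Adj v u) : ∃ i, N.nbr v i = u :=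
  ⟨(N.port v).symm ⟨u, h⟩, by rw [nbr, Equiv.apply_symm_apply]⟩

/-- The port at the other end of an edge. -/
def backPort (v : V) (i : Fin (G.degree v)) : Fin (G.degree (N.nbr v i)) :=
  (N.port (N.nbr v i)).symm ⟨v, (N.adj_nbr v i).symm⟩

theorem nbr_backPort (v : V) (i : Fin (G.degree v)) : N.nbr (N.nbr v i) (N.backPort v i) = v := by
  rw [nbr, backPort, Equiv.apply_symm_apply]

section Protocol

variable {σ μ Output : Type} (P : Protocol σ μ)

/-- The messages that `v` receives when the states are `s`. -/
def received (s : V → σ) (v : V) (i : ℕ) : Option μ :=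
  if h : i < G.degree v then some (P.send (s (N.nbr v ⟨i, h⟩)) (N.backPort v ⟨i, h⟩)) else none

/-- The state of the node `v` after `t` rounds of a protocol. -/
def run : ℕ → V → σ
  | 0, v => P.init (Fintype.card V) (N.ident v) (G.degree v)
  | t + 1, v => P.receive (run t v) (N.received P (run t) v)

theorem received_port (s : V → σ) (v : V) (i : Fin (G.degree v)) :
    N.received P s v i = some (P.send (s (N.nbr v i)) (N.backPort v i)) := by
  simp [received]

theorem received_eq_none (s : V → σ) (v : V) {i : ℕ} (hi : ¬ i < G.degree v) :
    N.received P s v i = none := dif_neg hi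

/-- In the run of a protocol, all nodes get their outputs `f` after `T` rounds, and not before. -/
def StopsAt (out : σ → Option Output) (T : ℕ) (f : V → Output) : Prop :=
  (∀ t < T, ∀ v, out (N.run P t v) = none) ∧ ∀ v, out (N.run P T v) = some (f v)

variable {N P} [Encodable μ] {out : σ → Option Output} {T : ℕ} {f : V → Output}

theorem StopsAt.state_eq_run (h : N.StopsAt P out T f) (t : ℕ) :
    N.state (P.toAlgorithm out) t = N.run P (min t T) := by
  induction t with
  | zero => rw [Nat.zero_min]; rfl
  | succ t ih =>
    funext v
    rw [state, ih]
    obtain hT | hT := lt_or_ge t T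
    · have hrunning := h.1 t hT
      rw [min_eq_left hT.le, min_eq_left (Nat.succ_le_of_lt hT), run]
      simp only [CongestAlgorithm.next, Protocol.toAlgorithm, hrunning]
      congr 1
      funext i
      by_cases hi : i < G.degree v
      · simp only [inbox, received, hi, dite_true, CongestAlgorithm.message, nbr, backPort]
        rw [hrunning]
        exact Encodable.encodek _
      · simp only [inbox, received, hi, dite_false, Option.bind_none]
    · rw [min_eq_right hT, min_eq_right (hT.trans t.le_succ)]
      simp only [CongestAlgorithm.next, Protocol.toAlgorithm, h.2 v]

theorem StopsAt.outputsWithin (h : N.StopsAt P out T f) {T' : ℕ} (hT : T ≤ T') :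
    N.OutputsWithin (P.toAlgorithm out) T' f := fun v => by
  rw [h.state_eq_run, min_eq_right hT]
  exact h.2 v

theorem StopsAt.respectsBandwidth (h : N.StopsAt P out T f) {β : ℕ}
    (hsize : ∀ t v i, i < G.degree v → (Encodable.encode (P.send (N.run P t v) i)).size
      ≤ β * Nat.clog 2 (Fintype.card V)) :
    N.RespectsBandwidth (P.toAlgorithm out) β := by
  intro t v i hi m hm
  rw [h.state_eq_run] at hm
  simp only [CongestAlgorithm.message, Protocol.toAlgorithm] at hm
  split at hm
  · simp at hm
  · exact Option.some.inj hm ▸ hsize _ v i hi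

end Protocol

end CongestNetwork

section Flooding

open Finset

/-- What a node keeps while it floods tokens through a network, one token per round. -/
structure Buffer (α : Type*) where
  /-- The tokens that the node has formed or received. -/
  known : Finset α
  /-- The tokens that the node has sent. -/
  sent : Finset α

namespace Buffer

variable {α : Type*} [DecidableEq α] (b : Buffer α) {x : α}

/-- The token sent next: an arbitrary one that is known and has not been sent. -/
noncomputable def pending : Option α :=
  if h : (b.known \ b.sent).Nonempty then some h.choose else none

theorem mem_of_pending_eq_some (h : b.pending = some x) : x ∈ b.known ∧ x ∉ b.sent := by
  rw [pending] at h
  split_ifs at h with hne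
  rw [← Option.some.inj h]
  exact mem_sdiff.1 hne.choose_spec

theorem exists_pending_eq_some (hx : x ∈ b.known) (hx' : x ∉ b.sent) :
    ∃ y, b.pending = some y :=
  ⟨_, dif_pos ⟨x, mem_sdiff.2 ⟨hx, hx'⟩⟩⟩

/-- The buffer after one round in which the tokens `new` have arrived. -/
noncomputable def update (new : Finset α) : Buffer α :=
  ⟨b.known ∪ new, b.sent ∪ b.pending.toFinset⟩

end Buffer

variable {V α : Type*} [DecidableEq α]

/-- The buffers `b t v` at the nodes `v` of `G` after `t` rounds evolve by flooding, when the node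
`v` contributes the tokens `own t v` itself in round `t`. -/
structure IsFlooding (G : SimpleGraph V) (own : ℕ → V → Finset α) (b : ℕ → V → Buffer α) :
    Prop where
  zero : ∀ v, b 0 v = ⟨∅, ∅⟩
  exists_update : ∀ t v, ∃ new, b (t + 1) v = (b t v).update new ∧
    ∀ x, x ∈ new ↔ (∃ u, G.Adj v u ∧ (b t u).pending = some x) ∨ x ∈ own (t + 1) v

namespace IsFlooding

variable {G : SimpleGraph V} {own : ℕ → V → Finset α} {b : ℕ → V → Buffer α}
  (hb : IsFlooding G own b) {A : Finset α} {t : ℕ} {u v : V} {x : α}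
include hb

theorem mem_known_succ : x ∈ (b (t + 1) v).known ↔ x ∈ (b t v).known ∨
    (∃ u, G.Adj v u ∧ (b t u).pending = some x) ∨ x ∈ own (t + 1) v := by
  obtain ⟨new, hupdate, hnew⟩ := hb.exists_update t v
  rw [hupdate, Buffer.update, mem_union, hnew]

theorem sent_succ (t : ℕ) (v : V) :
    (b (t + 1) v).sent = (b t v).sent ∪ (b t v).pending.toFinset := by
  obtain ⟨new, hupdate, -⟩ := hb.exists_update t v
  rw [hupdate, Buffer.update]

theorem known_mono (v : V) : Monotone fun t => (b t v).known :=
  monotone_nat_of_le_succ fun _ _ hx => hb.mem_known_succ.2 (.inl hx)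

theorem known_subset (hA : ∀ t v, own t v ⊆ A) (t : ℕ) (v : V) : (b t v).known ⊆ A := by
  induction t generalizing v with
  | zero => simp [hb.zero]
  | succ t ih =>
    intro x hx
    rcases hb.mem_known_succ.1 hx with hx | ⟨u, -, hx⟩ | hx
    · exact ih v hx
    · exact ih u ((b t u).mem_of_pending_eq_some hx).1
    · exact hA _ _ hx

theorem sent_subset_known (t : ℕ) (h : u = v ∨ G.Adj v u) : (b t u).sent ⊆ (b t v).known := by
  induction t with
  | zero => simp [hb.zero]
  | succ t ih =>
    intro x hx
    rw [hb.sent_succ, mem_union, Option.mem_toFinset, Option.mem_def] at hx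
    rw [hb.mem_known_succ]
    rcases hx with hx | hx
    · exact .inl (ih hx)
    · rcases h with rfl | h
      · exact .inl ((b t u).mem_of_pending_eq_some hx).1
      · exact .inr (.inl ⟨u, h, hx⟩)

-- As long as `x` waits, the node sends a new token in every round.
theorem mem_sent_or_le_card_sent (hx : x ∈ (b t v).known) (r : ℕ) :
    x ∈ (b (t + r) v).sent ∨ r ≤ #(b (t + r) v).sent := by
  induction r with
  | zero => exact .inr (Nat.zero_le _)
  | succ r ih =>
    rw [← add_assoc, hb.sent_succ]
    by_cases hsent : x ∈ (b (t + r) v).sent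
    · exact .inl (mem_union_left _ hsent)
    have hknown := hb.known_mono v (Nat.le_add_right t r) hx
    obtain ⟨y, hy⟩ := (b (t + r) v).exists_pending_eq_some hknown hsent
    have hy' := ((b (t + r) v).mem_of_pending_eq_some hy).2
    rw [hy, Option.toFinset_some, union_singleton, card_insert_of_notMem hy']
    exact .inr (Nat.succ_le_succ (ih.resolve_left hsent))

theorem mem_sent_of_mem_known (hA : ∀ t v, own t v ⊆ A) (hx : x ∈ (b t v).known) :
    x ∈ (b (t + (#A + 1)) v).sent := by
  refine (hb.mem_sent_or_le_card_sent hx (#A + 1)).resolve_right fun hcard => ?_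
  have hsent := card_le_card ((hb.sent_subset_known (t + (#A + 1)) (.inl rfl)).trans
    (hb.known_subset hA _ v))
  omega

theorem mem_known_of_walk (hA : ∀ t v, own t v ⊆ A) (p : G.Walk u v)
    (hx : x ∈ (b t u).known) : x ∈ (b (t + p.length * (#A + 1)) v).known := by
  induction p generalizing t with
  | nil => simpa using hx
  | cons h p ih =>
    have hnext := hb.sent_subset_known _ (.inr h.symm) (hb.mem_sent_of_mem_known hA hx)
    have hlength : t + (p.length + 1) * (#A + 1) = t + (#A + 1) + p.length * (#A + 1) := by ring
    rw [SimpleGraph.Walk.length_cons, hlength]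
    exact ih hnext

end IsFlooding

end Flooding

/-! ### The gathering protocol -/

section Encoding

theorem pair_lt_pow_two_mul {a b B k : ℕ} (ha : a < B ^ k) (hb : b < B ^ k) :
    Nat.pair a b < B ^ (2 * k) := by
  rw [two_mul, pow_add, ← sq]
  exact (Nat.pair_lt_max_add_one_sq a b).trans_le
    (Nat.pow_le_pow_left (Nat.succ_le_of_lt (max_lt ha hb)) 2)

/-- The components of a token, grouped so that its code is small. -/
def ClassToken.equivProd : ClassToken ≃ (ℕ × ℕ) × ℕ × ℕ where
  toFun t := ((t.rep, t.size), t.traceCard, t.item)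
  invFun p := ⟨p.1.1, p.1.2, p.2.1, p.2.2⟩

instance : Encodable ClassToken := Encodable.ofEquiv _ ClassToken.equivProd

theorem ClassToken.encode_lt {t : ClassToken} {B : ℕ} (hrep : t.rep < B) (hsize : t.size < B)
    (htrace : t.traceCard < B) (hitem : t.item < B) : Encodable.encode t < B ^ 4 := by
  rw [← pow_one B] at hrep hsize htrace hitem
  exact pair_lt_pow_two_mul (pair_lt_pow_two_mul hrep hsize) (pair_lt_pow_two_mul htrace hitem)

/-- What a node tells a neighbour in one round of gathering. -/
structure Message where
  /-- The identifier of the sender. -/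
  ident : ℕ
  /-- The degree of the sender. -/
  deg : ℕ
  /-- Whether the sender is in the degree cover. -/
  inCover : Bool
  /-- The identifier of one neighbour of the sender. -/
  item : ℕ
  /-- The label of the receiver, if it is not in the degree cover. -/
  label : ℕ × ℕ
  /-- A token that is flooded. -/
  token : Option ClassToken

namespace Message

instance : Inhabited Message := ⟨⟨0, 0, false, 0, (0, 0), none⟩⟩

/-- The components of a message, grouped so that its code is small. -/
def equivProd : Message ≃ ((ℕ × ℕ) × Bool × ℕ) × (ℕ × ℕ) × Option ClassToken where
  toFun m := (((m.ident, m.deg), m.inCover, m.item), m.label, m.token)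
  invFun p := ⟨p.1.1.1, p.1.1.2, p.1.2.1, p.1.2.2, p.2.1, p.2.2⟩

instance : Encodable Message := Encodable.ofEquiv _ equivProd

theorem encode_lt {m : Message} {B : ℕ} (hB : 2 ≤ B) (hident : m.ident < B) (hdeg : m.deg < B)
    (hitem : m.item < B) (hlabel : m.label.1 < B ∧ m.label.2 < B)
    (htoken : ∀ t ∈ m.token, Encodable.encode t < B ^ 4) : Encodable.encode m < B ^ 32 := by
  have hmono {k l : ℕ} (h : k ≤ l) : B ^ k ≤ B ^ l := Nat.pow_le_pow_right (by omega) h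
  have hcover : Encodable.encode m.inCover < B := by
    cases m.inCover <;> simp <;> omega
  have hoption : Encodable.encode m.token < B ^ 8 := by
    cases htok : m.token with
    | none => exact Nat.pow_pos (by omega)
    | some t =>
      rw [Encodable.encode_some]
      exact (Nat.succ_le_of_lt (htoken t htok)).trans_lt (Nat.pow_lt_pow_right hB (by norm_num))
  rw [← pow_one B] at hident hdeg hitem hlabel hcover
  have hleft := pair_lt_pow_two_mul (pair_lt_pow_two_mul hident hdeg)
    (pair_lt_pow_two_mul hcover hitem)
  have hright := pair_lt_pow_two_mul
    ((pair_lt_pow_two_mul hlabel.1 hlabel.2).trans_le (hmono (by norm_num))) hoption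
  exact pair_lt_pow_two_mul (hleft.trans_le (hmono (by norm_num))) hright

end Message

end Encoding

section GatherProtocol

open Finset

/-- The local state of a node in the gathering protocol: besides its initial knowledge, the number
of rounds and the messages received by round and port, and the tokens being flooded. -/
structure NodeState where
  /-- The number of nodes. -/
  num : ℕ
  /-- The identifier of the node. -/
  ident : ℕ
  /-- The degree of the node. -/
  deg : ℕ
  /-- The number of rounds made. -/
  time : ℕ
  /-- The messages received, by round (starting with `0`) and port. -/
  hist : ℕ → ℕ → Message
  /-- The tokens known and sent. -/
  buffer : Buffer ClassToken

namespace NodeState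

variable (s : NodeState)

/-- The identifier of the neighbour at a port. -/
def nbrIdent (i : ℕ) : ℕ := (s.hist 0 i).ident

/-- The degree of the neighbour at a port. -/
def nbrDeg (i : ℕ) : ℕ := (s.hist 0 i).deg

/-- The node is in the degree cover. -/
def InCover : Prop := ∃ i < s.deg, s.nbrDeg i ≤ s.deg

/-- The neighbour at a port is in the degree cover. It knows this only after round `0`. -/
def NbrInCover (i : ℕ) : Prop := (s.hist 1 i).inCover = true

/-- The identifiers of the neighbours of the neighbour at a port, which takes one round for each of
them to tell. -/
def nbrTrace (i : ℕ) : Finset ℕ := (range (s.nbrDeg i)).image fun j => (s.hist (j + 1) i).item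

/-- The neighbours outside the degree cover have told all their neighbours. -/
def Ready : Prop := 2 ≤ s.time ∧ ∀ i < s.deg, ¬ s.NbrInCover i → s.nbrDeg i < s.time

open scoped Classical in
/-- The identifiers of the cover vertices in the closed neighbourhood of a node of the cover. -/
noncomputable def selfTrace : Finset ℕ :=
  insert s.ident (((range s.deg).filter s.NbrInCover).image s.nbrIdent)

open scoped Classical in
/-- The identifiers of the neighbours outside the degree cover whose neighbours are `T`. When `T`
is the neighbourhood of one of them, these form its whole twin class. -/
noncomputable def twinIdents (T : Finset ℕ) : Finset ℕ :=
  ((range s.deg).filter fun i => ¬ s.NbrInCover i ∧ s.nbrTrace i = T).image s.nbrIdent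

open scoped Classical in
/-- The tokens that the node can form from what it has heard from its neighbours: those of its own
class if it is in the degree cover, and those of its neighbours outside the degree cover. -/
noncomputable def ownTokens : Finset ClassToken :=
  if s.Ready then
    (if s.InCover then classTokens {s.ident} s.selfTrace else ∅) ∪
      ((range s.deg).filter fun i => ¬ s.NbrInCover i).biUnion fun i =>
        classTokens (s.twinIdents (s.nbrTrace i)) (s.nbrTrace i)
  else ∅

open scoped Classical in
/-- The label of the neighbour at a port, if it is not in the degree cover. -/
noncomputable def nbrLabel (i : ℕ) : ℕ × ℕ :=
  if s.Ready ∧ ¬ s.NbrInCover i then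
    classLabel (s.twinIdents (s.nbrTrace i)) (s.nbrIdent i) else (0, 0)

open scoped Classical in
/-- The label of the node, which it learns from a neighbour if it is not in the degree cover. -/
noncomputable def label : ℕ × ℕ :=
  if s.InCover then classLabel {s.ident} s.ident else (s.hist (s.time - 1) 0).label

open scoped Classical in
/-- The message sent through a port. -/
noncomputable def message (i : ℕ) : Message where
  ident := s.ident
  deg := s.deg
  inCover := decide s.InCover
  item := s.nbrIdent (s.time - 1)
  label := s.nbrLabel i
  token := s.buffer.pending

/-- Store the messages received in one round. -/
def record (inbox : ℕ → Option Message) : NodeState :=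
  { s with
    time := s.time + 1
    hist := Function.update s.hist s.time fun i => (inbox i).getD default }

/-- The state after one round: messages are stored, and tokens are flooded. -/
noncomputable def receive (inbox : ℕ → Option Message) : NodeState :=
  { s.record inbox with
    buffer := s.buffer.update <|
      ((range s.deg).biUnion fun i => ((inbox i).bind Message.token).toFinset) ∪
        (s.record inbox).ownTokens }

end NodeState

/-- The protocol by which all nodes learn the tokens describing the graph, and their labels. -/
noncomputable def gather : Protocol NodeState Message where
  init n a d := ⟨n, a, d, 0, fun _ _ => default, ⟨∅, ∅⟩⟩
  send := NodeState.message
  receive := NodeState.receive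

end GatherProtocol

namespace CongestNetwork

open Finset

variable {V : Type} [Fintype V] {G : SimpleGraph V} [DecidableRel G.Adj] {c : ℕ}
  (N : CongestNetwork G c)

/-- The degree cover, with the identifiers of the network. -/
noncomputable def identifiedCover : IdentifiedCover G :=
  ⟨degreeCover G, isVertexCover_degreeCover, N.ident, N.ident_injective⟩

theorem num_run_gather (t : ℕ) (v : V) : (N.run gather t v).num = Fintype.card V := by
  induction t with
  | zero => rfl
  | succ _ ih => exact ih

theorem ident_run_gather (t : ℕ) (v : V) : (N.run gather t v).ident = N.ident v := by
  induction t with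
  | zero => rfl
  | succ _ ih => exact ih

theorem deg_run_gather (t : ℕ) (v : V) : (N.run gather t v).deg = G.degree v := by
  induction t with
  | zero => rfl
  | succ _ ih => exact ih

theorem time_run_gather (t : ℕ) (v : V) : (N.run gather t v).time = t := by
  induction t with
  | zero => rfl
  | succ _ ih => exact congrArg (· + 1) ih

theorem hist_run_gather {r t : ℕ} (h : r < t) (v : V) (i : ℕ) :
    (N.run gather t v).hist r i = (N.received gather (N.run gather r) v i).getD default := by
  induction t with
  | zero => omega
  | succ t ih =>
    change Function.update (N.run gather t v).hist (N.run gather t v).time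
      (fun i => (N.received gather (N.run gather t) v i).getD default) r i = _
    rw [time_run_gather]
    obtain hr | rfl := Nat.lt_succ_iff_lt_or_eq.1 h
    · rw [Function.update_of_ne hr.ne, ih hr]
    · rw [Function.update_self]

theorem hist_run_gather_port {r t : ℕ} (h : r < t) (v : V) (i : Fin (G.degree v)) :
    (N.run gather t v).hist r i = (N.run gather r (N.nbr v i)).message (N.backPort v i) := by
  rw [N.hist_run_gather h, received_port]
  rfl

section Knowledge

variable {t : ℕ} {v : V}

theorem nbrIdent_run_gather (ht : 1 ≤ t) (i : Fin (G.degree v)) :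
    (N.run gather t v).nbrIdent i = N.ident (N.nbr v i) := by
  rw [NodeState.nbrIdent, N.hist_run_gather_port ht]
  exact N.ident_run_gather _ _

theorem nbrDeg_run_gather (ht : 1 ≤ t) (i : Fin (G.degree v)) :
    (N.run gather t v).nbrDeg i = G.degree (N.nbr v i) := by
  rw [NodeState.nbrDeg, N.hist_run_gather_port ht]
  exact N.deg_run_gather _ _

theorem inCover_run_gather (ht : 1 ≤ t) : (N.run gather t v).InCover ↔ v ∈ degreeCover G := by
  rw [NodeState.InCover, mem_degreeCover, N.deg_run_gather]
  constructor
  · rintro ⟨i, hi, hdeg⟩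
    rw [N.nbrDeg_run_gather ht ⟨i, hi⟩] at hdeg
    exact ⟨_, N.adj_nbr v _, hdeg⟩
  · rintro ⟨u, hu, hdeg⟩
    obtain ⟨i, rfl⟩ := N.exists_nbr_eq hu
    exact ⟨i, i.2, by rwa [N.nbrDeg_run_gather ht]⟩

theorem nbrInCover_run_gather (ht : 2 ≤ t) (i : Fin (G.degree v)) :
    (N.run gather t v).NbrInCover i ↔ N.nbr v i ∈ degreeCover G := by
  rw [NodeState.NbrInCover, N.hist_run_gather_port ht, ← N.inCover_run_gather le_rfl]
  exact @decide_eq_true_iff _ (Classical.propDecidable _)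

theorem nbrTrace_run_gather {i : Fin (G.degree v)} (hi : N.nbr v i ∉ degreeCover G)
    (ht : G.degree (N.nbr v i) < t) :
    (N.run gather t v).nbrTrace i = N.identifiedCover.trace (N.nbr v i) := by
  have hitem (j : Fin (G.degree (N.nbr v i))) :
      ((N.run gather t v).hist (j + 1) i).item = N.ident (N.nbr (N.nbr v i) j) := by
    rw [N.hist_run_gather_port (by omega), NodeState.message, N.time_run_gather,
      Nat.add_sub_cancel, N.nbrIdent_run_gather (Nat.le_add_left 1 j)]
  rw [NodeState.nbrTrace, N.nbrDeg_run_gather (by omega), N.identifiedCover.trace_of_notMem hi]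
  ext x
  simp only [mem_image, mem_range, mem_map, SimpleGraph.mem_neighborFinset]
  constructor
  · rintro ⟨j, hj, rfl⟩
    exact ⟨_, N.adj_nbr _ ⟨j, hj⟩, (hitem ⟨j, hj⟩).symm⟩
  · rintro ⟨w, hw, rfl⟩
    obtain ⟨j, rfl⟩ := N.exists_nbr_eq hw
    exact ⟨j, j.2, hitem j⟩

theorem degree_le_of_notMem_degreeCover (hv : v ∉ degreeCover G) :
    G.degree v ≤ #(degreeCover G) :=
  card_le_card fun u hu =>
    (isVertexCover_degreeCover ((G.mem_neighborFinset v u).1 hu)).resolve_left hv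

theorem ready_run_gather (ht : #(degreeCover G) + 2 ≤ t) : (N.run gather t v).Ready := by
  refine ⟨by rw [time_run_gather]; omega, fun i hi hcover => ?_⟩
  rw [deg_run_gather] at hi
  rw [N.nbrInCover_run_gather (by omega) ⟨i, hi⟩] at hcover
  have hdeg := degree_le_of_notMem_degreeCover hcover
  rw [time_run_gather, N.nbrDeg_run_gather (by omega) ⟨i, hi⟩]
  omega

end Knowledge

section Ready

variable {N} {t : ℕ} {v : V} (hready : (N.run gather t v).Ready)
include hready

theorem two_le_of_ready : 2 ≤ t :=
  (N.time_run_gather t v) ▸ hready.1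

theorem nbrTrace_of_ready {i : Fin (G.degree v)} (hi : N.nbr v i ∉ degreeCover G) :
    (N.run gather t v).nbrTrace i = N.identifiedCover.trace (N.nbr v i) := by
  have ht := two_le_of_ready hready
  have hdeg := hready.2 i (by rw [deg_run_gather]; exact i.2) (by rwa [N.nbrInCover_run_gather ht])
  rw [N.nbrDeg_run_gather (by omega), time_run_gather] at hdeg
  exact N.nbrTrace_run_gather hi hdeg

-- The twins of a neighbour of `v` outside the cover are neighbours of `v` as well.
theorem twinIdents_of_ready {i : Fin (G.degree v)} (hi : N.nbr v i ∉ degreeCover G) :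
    (N.run gather t v).twinIdents ((N.run gather t v).nbrTrace i) =
      N.identifiedCover.classIdents (N.nbr v i) := by
  have ht := two_le_of_ready hready
  have htwin (j : Fin (G.degree v)) : (¬ (N.run gather t v).NbrInCover j ∧
      (N.run gather t v).nbrTrace j = (N.run gather t v).nbrTrace i) ↔
        N.nbr v j ∈ N.identifiedCover.twinClass (N.nbr v i) := by
    rw [N.identifiedCover.mem_twinClass_of_notMem hi, N.nbrInCover_run_gather ht,
      nbrTrace_of_ready hready hi]
    exact and_congr_right fun hj => by rw [nbrTrace_of_ready hready hj]
  ext x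
  simp only [NodeState.twinIdents, mem_image, mem_filter, mem_range, deg_run_gather,
    IdentifiedCover.classIdents, mem_map]
  constructor
  · rintro ⟨j, ⟨hj, h⟩, rfl⟩
    exact ⟨_, (htwin ⟨j, hj⟩).1 h, (N.nbrIdent_run_gather (by omega) ⟨j, hj⟩).symm⟩
  · rintro ⟨u, hu, rfl⟩
    have hv : v ∈ degreeCover G := N.identifiedCover.mem_cover_of_adj (N.adj_nbr v i).symm hi
    have hmem : N.ident v ∈ N.identifiedCover.trace u :=
      N.identifiedCover.trace_eq_of_mem_twinClass hu ▸
        N.identifiedCover.ident_mem_trace.2 ⟨hv, .inr (N.adj_nbr v i)⟩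
    have hu' : u ∉ degreeCover G := ((N.identifiedCover.mem_twinClass_of_notMem hi).1 hu).1
    have huv : G.Adj v u := (N.identifiedCover.ident_mem_trace.1 hmem).2.resolve_left
      fun huv => hu' (huv ▸ hv)
    obtain ⟨j, rfl⟩ := N.exists_nbr_eq huv
    exact ⟨j, ⟨j.2, (htwin j).2 hu⟩, N.nbrIdent_run_gather (by omega) j⟩

theorem selfTrace_of_ready (hv : v ∈ degreeCover G) :
    (N.run gather t v).selfTrace = N.identifiedCover.trace v := by
  have ht := two_le_of_ready hready
  ext x
  simp only [NodeState.selfTrace, mem_insert, mem_image, mem_filter, mem_range, ident_run_gather,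
    deg_run_gather, IdentifiedCover.trace, mem_map]
  constructor
  · rintro (rfl | ⟨i, ⟨hi, hcover⟩, rfl⟩)
    · exact ⟨v, ⟨hv, .inl rfl⟩, rfl⟩
    · exact ⟨N.nbr v ⟨i, hi⟩, ⟨(N.nbrInCover_run_gather ht ⟨i, hi⟩).1 hcover,
        .inr (N.adj_nbr v _).symm⟩, (N.nbrIdent_run_gather (by omega) ⟨i, hi⟩).symm⟩
  · rintro ⟨u, ⟨hu, rfl | h⟩, rfl⟩
    · exact .inl rfl
    · obtain ⟨i, rfl⟩ := N.exists_nbr_eq h.symm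
      exact .inr ⟨i, ⟨i.2, (N.nbrInCover_run_gather ht i).2 hu⟩,
        N.nbrIdent_run_gather (by omega) i⟩

theorem mem_ownTokens_of_ready {x : ClassToken} : x ∈ (N.run gather t v).ownTokens ↔
    (v ∈ degreeCover G ∧ x ∈ N.identifiedCover.vertexTokens v) ∨
      ∃ u, G.Adj v u ∧ u ∉ degreeCover G ∧ x ∈ N.identifiedCover.vertexTokens u := by
  have ht := two_le_of_ready hready
  rw [NodeState.ownTokens, if_pos hready, mem_union]
  refine or_congr ?_ ?_
  · rw [N.inCover_run_gather (by omega), ident_run_gather]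
    by_cases hv : v ∈ degreeCover G
    · rw [if_pos hv, selfTrace_of_ready hready hv, IdentifiedCover.vertexTokens,
        N.identifiedCover.classIdents_of_mem hv]
      exact (and_iff_right hv).symm
    · simp [hv]
  · have hnbr (i : Fin (G.degree v)) (hi : N.nbr v i ∉ degreeCover G) :
        classTokens ((N.run gather t v).twinIdents ((N.run gather t v).nbrTrace i))
          ((N.run gather t v).nbrTrace i) = N.identifiedCover.vertexTokens (N.nbr v i) := by
      rw [twinIdents_of_ready hready hi, nbrTrace_of_ready hready hi, IdentifiedCover.vertexTokens]
    simp only [mem_biUnion, mem_filter, mem_range, deg_run_gather]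
    constructor
    · rintro ⟨i, ⟨hi, hcover⟩, hx⟩
      rw [N.nbrInCover_run_gather ht ⟨i, hi⟩] at hcover
      rw [hnbr ⟨i, hi⟩ hcover] at hx
      exact ⟨_, N.adj_nbr v _, hcover, hx⟩
    · rintro ⟨u, hu, hcover, hx⟩
      obtain ⟨i, rfl⟩ := N.exists_nbr_eq hu
      rw [← hnbr i hcover] at hx
      exact ⟨i, ⟨i.2, mt (N.nbrInCover_run_gather ht i).1 hcover⟩, hx⟩

theorem nbrLabel_of_ready {i : Fin (G.degree v)} (hi : N.nbr v i ∉ degreeCover G) :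
    (N.run gather t v).nbrLabel i = N.identifiedCover.label (N.nbr v i) := by
  have ht := two_le_of_ready hready
  rw [NodeState.nbrLabel, if_pos ⟨hready, mt (N.nbrInCover_run_gather ht i).1 hi⟩,
    twinIdents_of_ready hready hi, N.nbrIdent_run_gather (by omega)]
  rfl

end Ready

theorem ownTokens_run_gather_subset (t : ℕ) (v : V) :
    (N.run gather t v).ownTokens ⊆ N.identifiedCover.tokens := by
  intro x hx
  by_cases hready : (N.run gather t v).Ready
  · rcases (mem_ownTokens_of_ready hready).1 hx with ⟨-, h⟩ | ⟨u, -, -, h⟩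
    exacts [N.identifiedCover.vertexTokens_subset_tokens v h,
      N.identifiedCover.vertexTokens_subset_tokens u h]
  · rw [NodeState.ownTokens, if_neg hready] at hx
    exact absurd hx (notMem_empty x)

theorem isFlooding_run_gather : IsFlooding G (fun t v => (N.run gather t v).ownTokens)
    fun t v => (N.run gather t v).buffer where
  zero _ := rfl
  exists_update t v := by
    refine ⟨_, rfl, fun x => ?_⟩
    rw [mem_union]
    refine or_congr_left ?_
    simp only [mem_biUnion, mem_range, deg_run_gather, Option.mem_toFinset, Option.mem_def]
    constructor
    · rintro ⟨i, hi, hx⟩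
      rw [N.received_port _ _ _ ⟨i, hi⟩] at hx
      exact ⟨_, N.adj_nbr v ⟨i, hi⟩, hx⟩
    · rintro ⟨u, hu, hx⟩
      obtain ⟨i, rfl⟩ := N.exists_nbr_eq hu
      exact ⟨i, i.2, by rwa [N.received_port]⟩

theorem known_run_gather_subset (t : ℕ) (v : V) :
    (N.run gather t v).buffer.known ⊆ N.identifiedCover.tokens :=
  N.isFlooding_run_gather.known_subset N.ownTokens_run_gather_subset t v

end CongestNetwork

section Output

open Finset

/-- A round in which `N` tokens are known to all nodes. As the degree cover has at most `N`
vertices, the tokens are formed within `N + 2` rounds, and then they travel along at most `2 * N`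
edges, in `N + 1` rounds each. -/
def stopTime (N : ℕ) : ℕ := 3 * (N + 1) ^ 2

namespace NodeState

/-- The node knows all tokens, because their shares add up to the number of nodes, and so much time
has passed that all other nodes know them, too. -/
def Finished (s : NodeState) : Prop :=
  ∑ t ∈ s.buffer.known, t.share = s.num ∧ stopTime #s.buffer.known ≤ s.time

variable {Output : Type} (P : (L : Type) → [Finite L] → SimpleGraph L → L → Output)

open scoped Classical in
/-- The output of a node that applies `P` to the communication graph and its own position in it. A
single node, which receives no tokens, is treated separately. -/
noncomputable def output (s : NodeState) : Option Output :=
  if s.num = 1 then some (P Unit ⊥ ())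
  else if h : s.Finished ∧ s.label ∈ tokenLabels s.buffer.known then
    some (P _ (labelGraph s.buffer.known) ⟨s.label, h.2⟩)
  else none

variable {s : NodeState}

theorem output_eq_some {K : Finset ClassToken} {l : ℕ × ℕ} (hnum : s.num ≠ 1) (hs : s.Finished)
    (hK : s.buffer.known = K) (hl : s.label = l) (hlK : l ∈ tokenLabels K) :
    s.output P = some (P _ (labelGraph K) ⟨l, hlK⟩) := by
  subst hK hl
  rw [output, if_neg hnum, dif_pos ⟨hs, hlK⟩]

theorem output_eq_none (hnum : s.num ≠ 1) (hs : ¬ s.Finished) : s.output P = none := by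
  rw [output, if_neg hnum, dif_neg fun h => hs h.1]

end NodeState

end Output

namespace CongestNetwork

open Finset

variable {V : Type} [Fintype V] {G : SimpleGraph V} [DecidableRel G.Adj] {c : ℕ}
  (N : CongestNetwork G c)

section Stopping

variable {t : ℕ}

theorem label_run_gather (hG : ∀ v, ∃ u, G.Adj v u) (ht : #(degreeCover G) + 3 ≤ t) (v : V) :
    (N.run gather t v).label = N.identifiedCover.label v := by
  rw [NodeState.label, N.inCover_run_gather (by omega), ident_run_gather, time_run_gather]
  by_cases hv : v ∈ degreeCover G
  · rw [if_pos hv, IdentifiedCover.label, N.identifiedCover.classIdents_of_mem hv]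
    rfl
  · obtain ⟨u, hu⟩ := hG v
    let i : Fin (G.degree v) := ⟨0, (G.degree_pos_iff_exists_adj v).2 ⟨u, hu⟩⟩
    have hback : N.nbr (N.nbr v i) (N.backPort v i) = v := N.nbr_backPort v i
    rw [if_neg hv, N.hist_run_gather_port (by omega) v i, NodeState.message,
      nbrLabel_of_ready (N.ready_run_gather (by omega)) (by rwa [hback]), hback]

theorem tokens_subset_known_run_gather (hG : ∀ v, ∃ u, G.Adj v u) (hconn : G.Preconnected)
    (ht : stopTime #N.identifiedCover.tokens ≤ t) (v : V) :
    N.identifiedCover.tokens ⊆ (N.run gather t v).buffer.known := by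
  intro x hx
  obtain ⟨u, hu⟩ := N.identifiedCover.mem_tokens.1 hx
  obtain ⟨w, hw⟩ : ∃ w, x ∈ (N.run gather (#(degreeCover G) + 2) w).ownTokens := by
    by_cases hcover : u ∈ degreeCover G
    · exact ⟨u, (mem_ownTokens_of_ready (N.ready_run_gather le_rfl)).2 (.inl ⟨hcover, hu⟩)⟩
    · obtain ⟨w, hw⟩ := hG u
      exact ⟨w, (mem_ownTokens_of_ready (N.ready_run_gather le_rfl)).2
        (.inr ⟨u, hw.symm, hcover, hu⟩)⟩
  obtain ⟨p, hp⟩ := (hconn w v).exists_isPath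
  have hknown := N.isFlooding_run_gather.mem_known_of_walk N.ownTokens_run_gather_subset p
    (N.isFlooding_run_gather.mem_known_succ.2 (.inr (.inr hw)))
  refine N.isFlooding_run_gather.known_mono v (le_trans ?_ ht) hknown
  have hlength : p.length ≤ 2 * #(degreeCover G) :=
    length_le_two_mul_card_of_isPath isVertexCover_degreeCover hp
  have hcover : #(degreeCover G) ≤ #N.identifiedCover.tokens :=
    N.identifiedCover.card_cover_le_card_tokens
  rw [stopTime]
  nlinarith

theorem finished_run_gather_iff (hG : ∀ v, ∃ u, G.Adj v u) (hconn : G.Preconnected) (v : V) :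
    (N.run gather t v).Finished ↔ stopTime #N.identifiedCover.tokens ≤ t := by
  rw [NodeState.Finished, num_run_gather, time_run_gather]
  constructor
  · rintro ⟨hsum, htime⟩
    rwa [N.identifiedCover.eq_tokens_of_sum_share hG (N.known_run_gather_subset t v) hsum] at htime
  · intro ht
    rw [(N.known_run_gather_subset t v).antisymm (N.tokens_subset_known_run_gather hG hconn ht v)]
    exact ⟨N.identifiedCover.sum_share_tokens hG, ht⟩

variable {Output : Type} (P : (L : Type) → [Finite L] → SimpleGraph L → L → Output)

theorem stopsAt_gather (hG : ∀ v, ∃ u, G.Adj v u) (hconn : G.Preconnected) :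
    N.StopsAt gather (NodeState.output P) (stopTime #N.identifiedCover.tokens)
      fun v => P _ (labelGraph N.identifiedCover.tokens) (N.identifiedCover.labelIso hG v) := by
  have hnum (t : ℕ) (v : V) : (N.run gather t v).num ≠ 1 := by
    obtain ⟨u, hu⟩ := hG v
    rw [num_run_gather]
    exact (Fintype.one_lt_card_iff.2 ⟨v, u, hu.ne⟩).ne'
  have hcover : #(degreeCover G) ≤ #N.identifiedCover.tokens :=
    N.identifiedCover.card_cover_le_card_tokens
  refine ⟨fun t ht v => ?_, fun v => ?_⟩
  · refine NodeState.output_eq_none P (hnum t v) ?_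
    rwa [N.finished_run_gather_iff hG hconn, not_le]
  · refine NodeState.output_eq_some P (hnum _ v) ((N.finished_run_gather_iff hG hconn v).2 le_rfl)
      ((N.known_run_gather_subset _ v).antisymm
        (N.tokens_subset_known_run_gather hG hconn le_rfl v))
      (N.label_run_gather hG ?_ v) _
    rw [stopTime]
    nlinarith

theorem stopsAt_gather_of_card_eq_one (hV : Fintype.card V = 1) :
    N.StopsAt gather (NodeState.output P) 0 fun _ => P Unit ⊥ () :=
  ⟨fun t ht => absurd ht t.not_lt_zero, fun v => if_pos ((N.num_run_gather 0 v).trans hV)⟩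

theorem stopTime_card_tokens_le {S : Finset V} (hS : G.IsVertexCover S) {τ : ℕ} (hτ : #S ≤ τ)
    (hpos : 1 ≤ τ) : stopTime #N.identifiedCover.tokens ≤ 2 ^ (14 * τ) := by
  have hself : τ + 1 ≤ 2 ^ τ := Nat.lt_two_pow_self
  have hcover : #(degreeCover G) ≤ 2 ^ τ * 2 ^ τ :=
    calc #(degreeCover G) ≤ #S + #S ^ 2 := card_degreeCover_le hS
      _ ≤ τ + τ ^ 2 := by gcongr
      _ = τ * (τ + 1) := by ring
      _ ≤ 2 ^ τ * 2 ^ τ := by gcongr; omega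
  have htokens : #N.identifiedCover.tokens ≤ 3 * (2 ^ τ * 2 ^ τ) * (2 ^ τ * 2 ^ τ) :=
    calc #N.identifiedCover.tokens
        ≤ (#(degreeCover G) + #S + 2 ^ #S) * #(degreeCover G) :=
          N.identifiedCover.card_tokens_le hS
      _ ≤ (2 ^ τ * 2 ^ τ + τ + 2 ^ τ) * (2 ^ τ * 2 ^ τ) := by gcongr; norm_num
      _ ≤ 3 * (2 ^ τ * 2 ^ τ) * (2 ^ τ * 2 ^ τ) := by gcongr; nlinarith
  calc stopTime #N.identifiedCover.tokens
      ≤ 2 ^ 2 * (2 ^ 2 * (2 ^ τ * 2 ^ τ * (2 ^ τ * 2 ^ τ))) ^ 2 := by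
        rw [stopTime]
        gcongr
        · norm_num
        · nlinarith [Nat.one_le_two_pow (n := τ + τ + (τ + τ)), pow_add 2 τ τ,
            pow_add 2 (τ + τ) (τ + τ)]
    _ = 2 ^ (6 + 8 * τ) := by ring
    _ ≤ 2 ^ (14 * τ) := Nat.pow_le_pow_right two_pos (by omega)

theorem exists_stopsAt_gather (hG : G.Connected) {τ : ℕ} (hτ : G.vertexCoverNum ≤ τ) :
    ∃ (L : Type) (_ : Finite L) (Γ : SimpleGraph L) (e : G ≃g Γ), ∃ T ≤ 2 ^ (14 * τ),
      N.StopsAt gather (NodeState.output P) T fun v => P L Γ (e v) := by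
  obtain ⟨v⟩ := hG.nonempty
  obtain hV | hV := subsingleton_or_nontrivial V
  · have hcard : Fintype.card V = 1 := Fintype.card_eq_one_iff.2 ⟨v, fun _ => Subsingleton.elim _ _⟩
    let e : G ≃g (⊥ : SimpleGraph Unit) :=
      ⟨Fintype.equivOfCardEq hcard, fun {u w} => by simp [Subsingleton.elim u w]⟩
    exact ⟨Unit, inferInstance, ⊥, e, 0, Nat.zero_le _, N.stopsAt_gather_of_card_eq_one P hcard⟩
  · obtain ⟨S, hS, hcover⟩ := G.vertexCoverNum_exists
    lift S to Finset V using S.toFinite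
    rw [Set.encard_coe_eq_coe_finsetCard] at hS
    have hcard : #S ≤ τ := by exact_mod_cast hS.trans_le hτ
    have hadj := hG.preconnected.exists_adj_of_nontrivial
    have hpos : 1 ≤ #S := by
      obtain ⟨u, hu⟩ := hadj v
      exact card_pos.2 ((hcover hu).elim (fun h => ⟨_, h⟩) fun h => ⟨_, h⟩)
    exact ⟨_, inferInstance, _, N.identifiedCover.labelIso hadj, _,
      N.stopTime_card_tokens_le hcover hcard (hpos.trans hcard),
      N.stopsAt_gather P hadj hG.preconnected⟩

end Stopping

section Bandwidth

theorem nbrIdent_run_gather_lt (t : ℕ) (v : V) (i : ℕ) :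
    (N.run gather t v).nbrIdent i < Fintype.card V ^ c := by
  have hpos : 0 < Fintype.card V ^ c := (Nat.zero_le _).trans_lt (N.ident_lt v)
  obtain rfl | ht := Nat.eq_zero_or_pos t
  · exact hpos
  by_cases hi : i < G.degree v
  · rw [N.nbrIdent_run_gather ht ⟨i, hi⟩]
    exact N.ident_lt _
  · rw [NodeState.nbrIdent, N.hist_run_gather ht, N.received_eq_none _ _ _ hi]
    exact hpos

theorem label_identifiedCover_lt (v : V) :
    (N.identifiedCover.label v).1 < Fintype.card V ^ c ∧
      (N.identifiedCover.label v).2 < Fintype.card V := by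
  obtain ⟨u, -, hu⟩ := N.identifiedCover.exists_ident_eq_rep v
  refine ⟨hu.symm.trans_lt (N.ident_lt u), ?_⟩
  exact (count_mem_lt_card (N.identifiedCover.self_mem_classIdents v)).trans_le
    ((card_map _).trans_le (card_le_univ _))

theorem nbrLabel_run_gather_lt (t : ℕ) (v : V) {i : ℕ} (hi : i < G.degree v) :
    ((N.run gather t v).nbrLabel i).1 < Fintype.card V ^ c ∧
      ((N.run gather t v).nbrLabel i).2 < Fintype.card V := by
  by_cases h : (N.run gather t v).Ready ∧ ¬ (N.run gather t v).NbrInCover i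
  · have hcover := mt (N.nbrInCover_run_gather (two_le_of_ready h.1) ⟨i, hi⟩).2 h.2
    rw [nbrLabel_of_ready h.1 hcover]
    exact N.label_identifiedCover_lt _
  · rw [NodeState.nbrLabel, if_neg h]
    exact ⟨(Nat.zero_le _).trans_lt (N.ident_lt v), Fintype.card_pos_iff.2 ⟨v⟩⟩

theorem encode_lt_of_mem_tokens {B : ℕ} (hcard : Fintype.card V < B)
    (hident : Fintype.card V ^ c ≤ B) {x : ClassToken} (hx : x ∈ N.identifiedCover.tokens) :
    Encodable.encode x < B ^ 4 := by
  obtain ⟨v, hv⟩ := N.identifiedCover.mem_tokens.1 hx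
  obtain ⟨hrep, hsize, htrace, hitem⟩ := mem_classTokens.1 hv
  obtain ⟨u, -, hu⟩ := N.identifiedCover.exists_ident_eq_rep v
  obtain ⟨w, -, hw⟩ := mem_map.1 hitem
  refine ClassToken.encode_lt ?_ ?_ ?_ ?_
  · exact (hrep.trans hu.symm).trans_lt ((N.ident_lt u).trans_le hident)
  · exact hsize.trans_lt (((card_map _).trans_le (card_le_univ _)).trans_lt hcard)
  · exact htrace.trans_lt (((N.identifiedCover.card_trace_le v).trans (card_le_univ _)).trans_lt
      hcard)
  · exact hw.symm.trans_lt ((N.ident_lt w).trans_le hident)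

theorem encode_message_run_gather_lt (t : ℕ) (v : V) {i : ℕ} (hi : i < G.degree v) :
    Encodable.encode ((N.run gather t v).message i) < (Fintype.card V ^ (c + 2)) ^ 32 := by
  have htwo : 2 ≤ Fintype.card V := by
    have := G.degree_lt_card_verts v
    omega
  have hcard : Fintype.card V < Fintype.card V ^ (c + 2) := lt_self_pow₀ htwo (by omega)
  have hident : Fintype.card V ^ c ≤ Fintype.card V ^ (c + 2) :=
    Nat.pow_le_pow_right (by omega) (by omega)
  have hlabel := N.nbrLabel_run_gather_lt t v hi
  refine Message.encode_lt (htwo.trans hcard.le) ?_ ?_ ?_ ?_ fun x hx => ?_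
  · exact (N.ident_run_gather t v).trans_lt ((N.ident_lt v).trans_le hident)
  · exact (N.deg_run_gather t v).trans_lt ((G.degree_lt_card_verts v).trans hcard)
  · exact (N.nbrIdent_run_gather_lt t v _).trans_le hident
  · exact ⟨hlabel.1.trans_le hident, hlabel.2.trans hcard⟩
  · exact N.encode_lt_of_mem_tokens hcard hident
      (N.known_run_gather_subset t v (Buffer.mem_of_pending_eq_some _ hx).1)

theorem size_message_run_gather_le (t : ℕ) (v : V) {i : ℕ} (hi : i < G.degree v) :
    (Encodable.encode ((N.run gather t v).message i)).size ≤
      32 * (c + 2) * Nat.clog 2 (Fintype.card V) := by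
  refine Nat.size_le.2 ((N.encode_message_run_gather_lt t v hi).trans_le ?_)
  calc (Fintype.card V ^ (c + 2)) ^ 32
      ≤ ((2 ^ Nat.clog 2 (Fintype.card V)) ^ (c + 2)) ^ 32 := by
        gcongr
        exact Nat.le_pow_clog one_lt_two _
    _ = 2 ^ (32 * (c + 2) * Nat.clog 2 (Fintype.card V)) := by
        rw [← pow_mul, ← pow_mul]
        congr 1
        ring

end Bandwidth

theorem gather_respectsBandwidth_and_outputsWithin {Output : Type}
    (P : (L : Type) → [Finite L] → SimpleGraph L → L → Output)
    (hG : G.Connected) {τ : ℕ} (hτ : G.vertexCoverNum ≤ τ) :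
    N.RespectsBandwidth (gather.toAlgorithm (NodeState.output P)) (32 * (c + 2)) ∧
      ∃ (L : Type) (_ : Finite L) (Γ : SimpleGraph L) (e : G ≃g Γ),
        N.OutputsWithin (gather.toAlgorithm (NodeState.output P)) (2 ^ (14 * τ))
          fun v => P L Γ (e v) := by
  obtain ⟨L, hL, Γ, e, T, hT, hstops⟩ := N.exists_stopsAt_gather P hG hτ
  exact ⟨hstops.respectsBandwidth fun t v _ hi => N.size_message_run_gather_le t v hi,
    L, hL, Γ, e, hstops.outputsWithin hT⟩

end CongestNetwork

theorem mainTheorem9_general :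
    ∃ C : ℕ, ∀ c : ℕ, ∃ β : ℕ,
      ∃ A : (W : Type) → [Finite W] → SimpleGraph W → CongestAlgorithm (Option W),
        ∀ (V : Type) [Fintype V] (G : SimpleGraph V) [DecidableRel G.Adj] (_ : G.Connected)
          (N : CongestNetwork G c) (W : Type) [Finite W] (H : SimpleGraph W) (τ : ℕ)
          (_ : G.vertexCoverNum ≤ τ),
          N.RespectsBandwidth (A W H) β ∧
            ∃ f : V → Option W,
              N.OutputsWithin (A W H) (2 ^ (C * τ)) f ∧
                IsMaximumCommonInducedSubgraph G H f := by
  refine ⟨14, fun c => ⟨32 * (c + 2), fun W _ H => gather.toAlgorithm <| NodeState.output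
    fun _ _ Γ => (exists_isMaximumCommonInducedSubgraph Γ H).choose, ?_⟩⟩
  intro V _ G _ hG N W _ H τ hτ
  obtain ⟨hbandwidth, L, _, Γ, e, hout⟩ := N.gather_respectsBandwidth_and_outputsWithin
    (fun _ _ Γ => (exists_isMaximumCommonInducedSubgraph Γ H).choose) hG hτ
  exact ⟨hbandwidth, _, hout,
    (exists_isMaximumCommonInducedSubgraph Γ H).choose_spec.comp_iso e⟩

theorem mainTheorem9 :
    ∃ C : ℕ, ∀ c : ℕ, ∃ β : ℕ,
      -- the program of the nodes may depend on the target graph, which every node knows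
      ∃ A : (m : ℕ) → SimpleGraph (Fin m) → CongestAlgorithm (Option (Fin m)),
        ∀ (V : Type) [Fintype V] (G : SimpleGraph V) [DecidableRel G.Adj] (_ : G.Connected)
          (N : CongestNetwork G c) (m : ℕ) (H : SimpleGraph (Fin m)) (τ : ℕ)
          (_ : max G.vertexCoverNum H.vertexCoverNum = (τ : ℕ∞)),
          N.RespectsBandwidth (A m H) β ∧
            ∃ f : V → Option (Fin m),
              N.OutputsWithin (A m H) (2 ^ (C * τ ^ 2)) f ∧
                IsMaximumCommonInducedSubgraph G H f := by
  obtain ⟨C, hC⟩ := mainTheorem9_general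
  refine ⟨C, fun c => (hC c).imp fun _ ⟨A, hA⟩ => ⟨fun m H => A (Fin m) H, ?_⟩⟩
  intro V _ G _ hG N m H τ hτ
  exact hA V G hG N (Fin m) H (τ ^ 2) <| (le_max_left _ _).trans <| hτ.trans_le <| by
    exact_mod_cast Nat.le_self_pow two_ne_zero τ
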